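/- Let $A$ be an associative unital ring that is $2$-torsion free ($2a=0$ implies $a=0$), let $r\ge 2$, and let $\bar k=(k_1,\dots,k_m)$ be positive integers with $k_1+\dots+k_m=r$. Let $B=B_r^{\bar k}(A)$ be the block upper triangular matrix ring, i.e. the subring of $M_r(A)$ of all matrices which, partitioned into blocks of sizes $k_i\times k_j$, have zero $(i,j)$ block whenever $i>j$. Assume $B\neq M_r(A)$, and let $n\ge 2$. Write $s\circ t=st+ts$, $q_1(t_1)=t_1$ and $q_j(t_1,\dots,t_j)=q_{j-1}(t_1,\dots,t_{j-1})\circ t_j$ for $j\ge 2$. Let $\Delta:B\to B$ be a multiplicative generalized Jordan $n$-derivation: a map, not assumed additive, for which there is a map $d:B\to B$, not assumed additive, such that for all $t_1,\dots,t_n\in B$ $$d(q_n(t_1,\dots,t_n))=\sum_{i=1}^n q_n(t_1,\dots,t_{i-1},d(t_i),t_{i+1},\dots,t_n),$$ $$\Delta(q_n(t_1,\dots,t_n))=q_n(\Delta(t_1),t_2,\dots,t_n)+\sum_{i=2}^n q_n(t_1,\dots,t_{i-1},d(t_i),t_{i+1},\dots,t_n).$$ Then there exist $\mu$ in the center of $A$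 and a derivation $\delta:B\to B$ (an additive map with $\delta(st)=\delta(s)t+s\delta(t)$ for all $s,t\in B$) such that $\Delta(t)=\mu t+\delta(t)$ for all $t\in B$, where $\mu t$ is the matrix obtained from $t$ by multiplying every entry by $\mu$. -/

import Mathlib

/-- The Jordan product `s ∘ t = s t + t s`. -/
def jordanProduct {R : Type*} [Ring R] (s t : R) : R := s * t + t * s

/-- The iterated Jordan product: `q₁(t₁) = t₁` and
`qₙ(t₁, …, tₙ) = qₙ₋₁(t₁, …, tₙ₋₁) ∘ tₙ` for `n ≥ 2` (the value at `n = 0` is irrelevant). -/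
def iteratedJordan {R : Type*} [Ring R] : (n : ℕ) → (Fin n → R) → R
  | 0, _ => 0
  | 1, t => t 0
  | n + 2, t => jordanProduct (iteratedJordan (n + 1) (Fin.init t)) (t (Fin.last (n + 1)))

/-- A multiplicative (not necessarily additive) Jordan `n`-derivation:
`δ(qₙ(t₁, …, tₙ)) = ∑ᵢ qₙ(t₁, …, δ(tᵢ), …, tₙ)`. -/
def IsMultJordanDerivation {R : Type*} [Ring R] (n : ℕ) (δ : R → R) : Prop :=
  ∀ t : Fin n → R,
    δ (iteratedJordan n t) = ∑ i : Fin n, iteratedJordan n (Function.update t i (δ (t i)))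

/-- `Δ` is a multiplicative (not necessarily additive) generalized Jordan `n`-derivation:
for some multiplicative Jordan `n`-derivation `δ`,
`Δ(qₙ(t₁, …, tₙ)) = qₙ(Δ(t₁), t₂, …, tₙ) + ∑_{i ≥ 2} qₙ(t₁, …, δ(tᵢ), …, tₙ)`.
The first argument has index `0` here. -/
def IsMultGenJordanDerivation {R : Type*} [Ring R] (n : ℕ) (Δ : R → R) : Prop :=
  ∃ δ : R → R, IsMultJordanDerivation n δ ∧
    ∀ t : Fin n → R,
      Δ (iteratedJordan n t) =
        ∑ i : Fin n, iteratedJordan n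
          (Function.update t i (if (i : ℕ) = 0 then Δ (t i) else δ (t i)))

/-- An (additive) derivation of a ring. -/
def IsRingDerivation {R : Type*} [Ring R] (δ : R → R) : Prop :=
  (∀ s t : R, δ (s + t) = δ s + δ t) ∧ ∀ s t : R, δ (s * t) = δ s * t + s * δ t

/-- The block upper triangular matrix ring with diagonal blocks of sizes `k₁, …, kₘ ≥ 1`,
`k₁ + ⋯ + kₘ = r`: the subring of `M_r(A)` of all matrices whose `(i, j)` entry vanishes whenever
the block containing `i` comes strictly after the block containing `j`. -/
def blockUpperTriangularRing (A : Type*) [Ring A] {r : ℕ} (k : Composition r) :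
    Subring (Matrix (Fin r) (Fin r) A) where
  carrier := {M | ∀ i j : Fin r, k.index j < k.index i → M i j = 0}
  mul_mem' := by
    intro M N hM hN i j hij
    rw [Matrix.mul_apply]
    refine Finset.sum_eq_zero fun l _ => ?_
    rcases lt_or_ge (k.index l) (k.index i) with h | h
    · rw [hM i l h, zero_mul]
    · rw [hN l j (lt_of_lt_of_le hij h), mul_zero]
  one_mem' := by
    intro i j hij
    exact Matrix.one_apply_ne (fun h => absurd hij (by simp [h]))
  add_mem' := by
    intro M N hM hN i j hij
    rw [Matrix.add_apply, hM i j hij, hN i j hij, add_zero]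
  zero_mem' := by
    intro i j _
    rfl
  neg_mem' := by
    intro M hM i j hij
    rw [Matrix.neg_apply, hM i j hij, neg_zero]

/-! Since `B` is not the full matrix ring, cutting between two blocks gives an idempotent `e` with
`(1 - e) B e = 0` and `M = e B (1 - e)` faithful on both sides; the argument then uses only `e` and
2-torsion freeness. Putting `1` in all slots but the first two turns the `n`-ary identities into
binary Jordan identities, up to a cancellable factor `N = 2 ^ (n - 2)` and a term in `d 1`.

The `d 1` terms cancel in `Δ - d`, which is therefore multiplication by a central element
(`exists_central_mul`). For `d` itself, `d 1` is central, and the arguments `(x, e, …, e)` with `x`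
in `M` give `(n - 1) • d 1 = 0`. It need not vanish when there is torsion, so `d` may keep a central
multiplication. Removing it and an inner derivation leaves a map killing `e` and `1 - e`. This map
respects the Peirce decomposition; it is additive on `M`, and faithfulness of `M` carries additivity
and the product rule to the diagonal corners (`isRingDerivation_of_jordan`). -/

/-- An idempotent `e` with `(1 - e) R e = 0` whose bimodule `e R (1 - e)` is faithful on both
sides. Membership of `x` in `e R (1 - e)` is expressed by `e * x = x` and `x * e = 0`. -/
structure IsTriangularIdempotent {R : Type*} [Ring R] (e : R) : Prop where
  idem : e * e = e
  corner : ∀ r, e * (r * e) = r * e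
  left_faithful : ∀ u, (∀ x, e * x = x → x * e = 0 → u * x = 0) → u * e = 0
  right_faithful : ∀ u, (∀ x, e * x = x → x * e = 0 → x * u = 0) → e * u = u

/-! ### Centrality tests and central multiplications -/

namespace IsTriangularIdempotent

variable {R : Type*} [Ring R] {e : R}

/-- As `M = e R (1 - e)` is stable under multiplication by `R` on both sides, every commutator `[c,
r]` annihilates `M` on both sides. Faithfulness leaves only its component in `M`, which is `[c, e *
r - r * e] = 0`. -/
theorem commute_of_commute_bimodule (he : IsTriangularIdempotent e) {c : R} (hce : c * e = e * c)
    (hc : ∀ x, e * x = x → x * e = 0 → c * x = x * c) (r : R) : c * r = r * c := by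
  have h1 : (c * r - r * c) * e = 0 := he.left_faithful _ fun x hx hx' => by
    have h := hc (r * x) (by rw [← hx, ← mul_assoc r, ← mul_assoc, he.corner])
      (by rw [mul_assoc, hx', mul_zero])
    rw [sub_mul, mul_assoc r c, hc x hx hx', mul_assoc c, h]
    noncomm_ring
  have h2 : e * (c * r - r * c) = c * r - r * c := he.right_faithful _ fun x hx hx' => by
    have h := hc (x * r) (by rw [← mul_assoc, hx])
      (by rw [mul_assoc, ← he.corner, ← mul_assoc, hx', zero_mul])
    rw [mul_sub, ← mul_assoc, ← hc x hx hx', mul_assoc c, h]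
    noncomm_ring
  have h3 := hc (e * r - r * e) (by rw [mul_sub, he.corner, ← mul_assoc, he.idem])
    (by rw [sub_mul, mul_assoc e, he.corner, mul_assoc, he.idem, sub_self])
  have h4 := he.corner (c * r - r * c)
  linear_combination (norm := noncomm_ring) h3 - h2 + h1 + r * hce - hce * r

theorem eq_zero_of_central (he : IsTriangularIdempotent e) {u : R} (hu : ∀ r, u * r = r * u)
    (h : ∀ x, e * x = x → x * e = 0 → u * x = 0) : u = 0 := by
  rw [← he.right_faithful u fun x hx hx' => by rw [← hu, h x hx hx'], ← hu, he.left_faithful u h]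

theorem mem_center_of_commutator_mem_center (he : IsTriangularIdempotent e) {c : R}
    (hc : ∀ s t, s * (c * t - t * c) = (c * t - t * c) * s) (r : R) : c * r = r * c := by
  have hce : c * e = e * c := by
    have h1 := hc e e
    have h2 := he.corner c
    have h3 := he.idem
    linear_combination (norm := noncomm_ring) h1 - 2 * h2 + h3 * c + c * h3
  refine he.commute_of_commute_bimodule hce (fun x hx hx' => ?_) r
  have h1 := hc e x
  linear_combination (norm := noncomm_ring) h1 - c * hx + hx * c + hce * x - x * hce + c * hx'
    - hx' * c

/-- A map with `φ (N • (s ∘ t)) = N • (φ s ∘ t)` is multiplication by a central element. -/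
theorem exists_central_mul (he : IsTriangularIdempotent e) (h2 : ∀ x y : R, 2 * x = 2 * y → x = y)
    {N : ℕ} (hN : ∀ x y : R, N • x = N • y → x = y) {φ : R → R}
    (hφ : ∀ s t, φ (N • (s * t + t * s)) = N • (φ s * t + t * φ s)) :
    ∃ c : R, (∀ r, c * r = r * c) ∧ ∀ t, φ t = c * t := by
  have hs : ∀ s t, φ s * t + t * φ s = φ t * s + s * φ t := fun s t => by
    refine hN _ _ ?_
    rw [← hφ, ← hφ, add_comm]
  have h1 : ∀ t, 2 * φ t = φ 1 * t + t * φ 1 := fun t => by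
    linear_combination (norm := noncomm_ring) hs t 1
  have hc : ∀ r, φ 1 * r = r * φ 1 := by
    -- Evaluating `φ` at `N • (s ∘ t)` in two ways gives `2 * (φ s ∘ t) = φ 1 ∘ (s ∘ t)`;
    -- substituting `2 * φ s = φ 1 ∘ s` leaves a vanishing double commutator.
    refine he.mem_center_of_commutator_mem_center fun s t => ?_
    have h3 := h1 (N • (s * t + t * s))
    rw [hφ] at h3
    have h4 : 2 * (φ s * t + t * φ s) = φ 1 * (s * t + t * s) + (s * t + t * s) * φ 1 := by
      refine hN _ _ ?_
      rw [← mul_smul_comm, h3, mul_smul_comm, smul_mul_assoc, smul_add]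
    linear_combination (norm := noncomm_ring) h4 - h1 s * t - t * h1 s
  refine ⟨φ 1, hc, fun t => h2 _ _ ?_⟩
  linear_combination (norm := noncomm_ring) h1 t - hc t

end IsTriangularIdempotent

/-! ### From a Jordan identity to a derivation, via Peirce components -/

namespace IsTriangularIdempotent

variable {R : Type*} [Ring R] {e : R}

/-- A map satisfying a rescaled Jordan identity and killing `e` and `1 - e` is a derivation. -/
theorem isRingDerivation_of_jordan (he : IsTriangularIdempotent e)
    (h2 : ∀ x y : R, 2 * x = 2 * y → x = y)
    {N : ℕ} (hN : ∀ x y : R, N • x = N • y → x = y) {D : R → R}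
    (hD : ∀ s t, D (N • (s * t + t * s)) = N • (D s * t + t * D s + (s * D t + D t * s)))
    (hDe : D e = 0) (hDf : D (1 - e) = 0) : IsRingDerivation D := by
  have hee := he.idem
  have hc := he.corner
  have D0 : D 0 = 0 := by simpa using hD 0 0
  have ge : ∀ t, D (N • (t * e + e * t)) = N • (D t * e + e * D t) := fun t => by
    simpa [hDe] using hD t e
  have gf : ∀ t, D (N • (t * (1 - e) + (1 - e) * t)) = N • (D t * (1 - e) + (1 - e) * D t) :=
    fun t => by simpa only [hDf, mul_zero, zero_mul, add_zero] using hD t (1 - e)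
  -- For `x` in `M`, both `x ∘ e` and `x ∘ (1 - e)` equal `x`; comparing the two images forces `D x`
  -- into `M`.
  have hM : ∀ x, e * x = x → x * e = 0 → e * D x = D x ∧ D x * e = 0 := fun x hx hx' => by
    have h1 := ge x
    have h3 := gf x
    rw [hx, hx', zero_add] at h1
    rw [show x * (1 - e) + (1 - e) * x = x by
      linear_combination (norm := noncomm_ring) -hx - hx', h1] at h3
    have h4 := hN _ _ h3
    have h5 : D x = D x * e + e * D x := h2 _ _ (by
      linear_combination (norm := noncomm_ring) -h4)
    have h6 : D x * e = 0 := by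
      linear_combination (norm := noncomm_ring) -h5 * e - hc (D x) - D x * hee
    exact ⟨by rw [h6, zero_add] at h5; exact h5.symm, h6⟩
  have hMN : ∀ x, e * x = x → x * e = 0 → D (N • x) = N • D x := fun x hx hx' => by
    have h1 := ge x
    rwa [hx, hx', zero_add, (hM x hx hx').1, (hM x hx hx').2, zero_add] at h1
  have hA : ∀ a, a * e = a → D a * e = D a := fun a ha => by
    have h1 := gf a
    have ha' : e * a = a := by rw [← ha, hc]
    rw [show a * (1 - e) + (1 - e) * a = 0 by
      linear_combination (norm := noncomm_ring) -ha - ha', smul_zero, D0, ← smul_zero N] at h1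
    have h3 := hN _ _ h1
    refine h2 _ _ ?_
    linear_combination (norm := noncomm_ring) h3 + e * h3 - hc (D a) - hee * D a
  have hB : ∀ b, e * b = 0 → e * D b = 0 := fun b hb => by
    have h1 := ge b
    have hb' : b * e = 0 := by rw [← hc, ← mul_assoc, hb, zero_mul]
    rw [hb, hb', add_zero, smul_zero, D0, ← smul_zero N] at h1
    have h3 := hN _ _ h1
    have h4 : D b * e = 0 := h2 _ _ (by
      linear_combination (norm := noncomm_ring) -h3 * e - D b * hee - hc (D b))
    rw [h4, zero_add] at h3
    exact h3.symm
  have hax : ∀ a x, a * e = a → e * x = x → x * e = 0 → D (a * x) = D a * x + a * D x := by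
    intro a x ha hx hx'
    have ha' : e * a = a := by rw [← ha, hc]
    have hxa : x * a = 0 := by rw [← ha', ← mul_assoc, hx', zero_mul]
    have h1 := hD a x
    rw [hxa, add_zero, hMN _ (by rw [← mul_assoc, ha']) (by rw [mul_assoc, hx', mul_zero])] at h1
    have h3 : x * D a = 0 := by rw [← hA a ha, ← hc, ← mul_assoc, hx', zero_mul]
    have h4 : D x * a = 0 := by rw [← ha', ← mul_assoc, (hM x hx hx').2, zero_mul]
    rw [h3, h4, add_zero, add_zero] at h1
    exact hN _ _ h1
  have hxb : ∀ x b, e * b = 0 → e * x = x → x * e = 0 → D (x * b) = D x * b + x * D b := by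
    intro x b hb hx hx'
    have hb' : b * e = 0 := by rw [← hc, ← mul_assoc, hb, zero_mul]
    have hbx : b * x = 0 := by rw [← hx, ← mul_assoc, hb', zero_mul]
    have h1 := hD x b
    rw [hbx, add_zero, hMN _ (by rw [← mul_assoc, hx]) (by rw [mul_assoc, hb', mul_zero])] at h1
    have h3 : D b * x = 0 := by
      rw [← hx, ← mul_assoc, ← hc, ← mul_assoc e, hB b hb, zero_mul, zero_mul]
    have h4 : b * D x = 0 := by rw [← (hM x hx hx').1, ← mul_assoc, hb', zero_mul]
    rw [h3, h4, add_zero, add_zero] at h1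
    exact hN _ _ h1
  have mulM : ∀ x y, x * e = 0 → e * y = y → x * y = 0 := fun x y hx hy => by
    rw [← hy, ← mul_assoc, hx, zero_mul]
  have addAM : ∀ a y, a * e = a → e * y = y → y * e = 0 → D (a + y) = D a + D y := by
    intro a y ha hy hy'
    have ha' : e * a = a := by rw [← ha, hc]
    obtain ⟨hDy, hDy'⟩ := hM y hy hy'
    have h1 := gf (a + y)
    rw [show (a + y) * (1 - e) + (1 - e) * (a + y) = y by
      linear_combination (norm := noncomm_ring) -ha - ha' - hy - hy', hMN y hy hy'] at h1
    have h3 := hN _ _ h1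
    have hw : e * D (a + y) = D (a + y) := h2 _ _ (by
      linear_combination (norm := noncomm_ring) h3 - e * h3 + hDy + hc (D (a + y))
        + hee * D (a + y))
    -- The Jordan product of `a + y` with `x` in `M` no longer sees `y`, so the corner part of `D (a
    -- + y)` is detected by its action on `M`.
    have h4 : (D (a + y) - D a) * e = 0 := he.left_faithful _ fun x hx hx' => by
      obtain ⟨hDx, hDx'⟩ := hM x hx hx'
      have h5 := hD (a + y) x
      rw [show (a + y) * x + x * (a + y) = a * x by
        linear_combination (norm := noncomm_ring) mulM y x hy' hx + mulM x a hx' ha' +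
          mulM x y hx' hy, hMN _ (by rw [← mul_assoc, ha']) (by rw [mul_assoc, hx', mul_zero])] at h5
      linear_combination (norm := noncomm_ring) hax a x ha hx hx' - hN _ _ h5
        - mulM x _ hx' hw - mulM y _ hy' hDx - mulM _ a hDx' ha' - mulM _ y hDx' hy
    linear_combination (norm := noncomm_ring) h4 + hA a ha - h3 + hw
  have addMB : ∀ y b, e * b = 0 → e * y = y → y * e = 0 → D (y + b) = D y + D b := by
    intro y b hb hy hy'
    have hb' : b * e = 0 := by rw [← hc, ← mul_assoc, hb, zero_mul]
    obtain ⟨hDy, hDy'⟩ := hM y hy hy'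
    have h1 := ge (y + b)
    rw [show (y + b) * e + e * (y + b) = y by
      linear_combination (norm := noncomm_ring) hb + hb' + hy + hy', hMN y hy hy'] at h1
    have h3 := hN _ _ h1
    have hw : D (y + b) * e = 0 := h2 _ _ (by
      linear_combination (norm := noncomm_ring) -h3 * e + hDy' - hc (D (y + b))
        - D (y + b) * hee)
    have h4 : e * (D (y + b) - D b) = D (y + b) - D b := he.right_faithful _ fun x hx hx' => by
      obtain ⟨hDx, hDx'⟩ := hM x hx hx'
      have h5 := hD (y + b) x
      rw [show (y + b) * x + x * (y + b) = x * b by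
        linear_combination (norm := noncomm_ring) mulM y x hy' hx + mulM b x hb' hx +
          mulM x y hx' hy, hMN _ (by rw [← mul_assoc, hx]) (by rw [mul_assoc, hb', mul_zero])] at h5
      linear_combination (norm := noncomm_ring) hxb x b hb hx hx' - hN _ _ h5
        - mulM _ x hw hx - mulM y _ hy' hDx - mulM b _ hb' hDx - mulM _ y hDx' hy
    linear_combination (norm := noncomm_ring) -h3 - h4 - hB b hb - hw
  have tM : ∀ t, e * (e * t - t * e) = e * t - t * e := fun t => by
    linear_combination (norm := noncomm_ring) hee * t - hc t
  have tM' : ∀ t, (e * t - t * e) * e = 0 := fun t => by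
    linear_combination (norm := noncomm_ring) hc t - t * hee
  have NM : ∀ x, e * x = x → e * (N • x) = N • x := fun x hx => by rw [mul_smul_comm, hx]
  have NM' : ∀ x, x * e = 0 → (N • x) * e = 0 := fun x hx => by rw [smul_mul_assoc, hx, smul_zero]
  have compM : ∀ t, D (e * t - t * e) = e * D t - D t * e := by
    intro t
    -- `(t ∘ e) ∘ (1 - e)` is the `M`-component of `t`, so `D` commutes with this projection before
    -- additivity is known.
    have h1 := gf (N • (t * e + e * t))
    rw [ge t, smul_mul_assoc, smul_mul_assoc, mul_smul_comm, mul_smul_comm, ← smul_add, ← smul_add,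
      show (t * e + e * t) * (1 - e) + (1 - e) * (t * e + e * t) = e * t - t * e by
        linear_combination (norm := noncomm_ring) -t * hee - hee * t - 2 * hc t,
      hMN _ (NM _ (tM t)) (NM' _ (tM' t)), hMN _ (tM t) (tM' t)] at h1
    rw [hN _ _ (hN _ _ h1)]
    linear_combination (norm := noncomm_ring) -D t * hee - hee * D t - 2 * hc (D t)
  have compA : ∀ t, D (t * e) = D t * e := by
    intro t
    have hte : t * e * e = t * e := by rw [mul_assoc, hee]
    have h1 := ge (t * e)
    have h3 := ge t
    rw [show t * e + e * t = (t * e * e + e * (t * e)) + (e * t - t * e) by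
      linear_combination (norm := noncomm_ring) -hte - hc t, smul_add, addAM _ _ (by
        rw [smul_mul_assoc]; congr 1
        linear_combination (norm := noncomm_ring) hte * e + hc t * e + hte - hc t) (NM _ (tM t)) (NM' _ (tM' t)), h1,
      hMN _ (tM t) (tM' t), compM, ← smul_add] at h3
    have h4 := hN _ _ h3
    have h5 := hA _ hte
    refine h2 _ _ ?_
    linear_combination (norm := noncomm_ring) h4 - 2 * h5 - hc (D (t * e)) + e * h5
  have compB : ∀ t, D (t - e * t) = D t - e * D t := by
    intro t
    have hte : e * (t - e * t) = 0 := by rw [mul_sub, ← mul_assoc, hee, sub_self]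
    have hte' : (t - e * t) * e = 0 := by
      linear_combination (norm := noncomm_ring) - hc t
    have h1 := gf (t - e * t)
    have h3 := gf t
    rw [show t * (1 - e) + (1 - e) * t = (e * t - t * e) +
      ((t - e * t) * (1 - e) + (1 - e) * (t - e * t)) by
      linear_combination (norm := noncomm_ring) hte + hte', smul_add, addMB _ _ (by
        rw [mul_smul_comm]
        rw [show e * ((t - e * t) * (1 - e) + (1 - e) * (t - e * t)) = 0 by
          linear_combination (norm := noncomm_ring) 2 * hte - hte * e - e * hte, smul_zero])
        (NM _ (tM t)) (NM' _ (tM' t)), h1,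
      hMN _ (tM t) (tM' t), compM, ← smul_add] at h3
    have h4 := hN _ _ h3
    have h5 := hB _ hte
    have h6 := hc (D (t - e * t))
    refine h2 _ _ ?_
    linear_combination (norm := noncomm_ring) h4 + h5 - h6 + h5 * e
  have split : ∀ t, D t = D (t * e) + D (e * t - t * e) + D (t - e * t) := fun t => by
    rw [compA, compM, compB]; noncomm_ring
  have addM : ∀ x y, e * x = x → x * e = 0 → e * y = y → y * e = 0 → D (x + y) = D x + D y := by
    intro x y hx hx' hy hy'
    obtain ⟨hDx, hDx'⟩ := hM x hx hx'
    obtain ⟨hDy, hDy'⟩ := hM y hy hy'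
    -- The Jordan product of `e + x` and `y + (1 - e)` is exactly `x + y`, which makes a sum in `M`
    -- accessible to the identity.
    have h1 := hD (e + x) (y + (1 - e))
    rw [addAM e x hee hx hx', addMB y (1 - e) (by rw [mul_sub, hee, mul_one, sub_self]) hy hy',
      hDe, hDf, zero_add, add_zero,
      show (e + x) * (y + (1 - e)) + (y + (1 - e)) * (e + x) = x + y by
        linear_combination (norm := noncomm_ring) mulM x y hx' hy + mulM y x hy' hx
          - hx' - hx + hy + hy' - 2 * hee,
      hMN _ (by rw [mul_add, hx, hy]) (by rw [add_mul, hx', hy', add_zero])] at h1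
    linear_combination (norm := noncomm_ring) hN _ _ h1 + mulM _ y hDx' hy + mulM y _ hy' hDx
      + mulM x _ hx' hDy + mulM _ x hDy' hx - hDx - hDx' + hDy + hDy'
  have addA : ∀ a b, a * e = a → b * e = b → D (a + b) = D a + D b := by
    intro a b ha hb
    have hab : (a + b) * e = a + b := by rw [add_mul, ha, hb]
    have h : (D (a + b) - (D a + D b)) * e = 0 := he.left_faithful _ fun x hx hx' => by
      have ha' : e * a = a := by rw [← ha, hc]
      have hb' : e * b = b := by rw [← hb, hc]
      have h1 := addM (a * x) (b * x) (by rw [← mul_assoc, ha']) (by rw [mul_assoc, hx', mul_zero])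
        (by rw [← mul_assoc, hb']) (by rw [mul_assoc, hx', mul_zero])
      rw [← add_mul, hax _ x hab hx hx', hax a x ha hx hx', hax b x hb hx hx'] at h1
      linear_combination (norm := noncomm_ring) h1
    linear_combination (norm := noncomm_ring) h - hA _ hab + hA a ha + hA b hb
  have addB : ∀ a b, e * a = 0 → e * b = 0 → D (a + b) = D a + D b := by
    intro a b ha hb
    have hab : e * (a + b) = 0 := by rw [mul_add, ha, hb, add_zero]
    have h : e * (D (a + b) - (D a + D b)) = D (a + b) - (D a + D b) :=
        he.right_faithful _ fun x hx hx' => by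
      have ha' : a * e = 0 := by rw [← hc, ← mul_assoc, ha, zero_mul]
      have hb' : b * e = 0 := by rw [← hc, ← mul_assoc, hb, zero_mul]
      have h1 := addM (x * a) (x * b) (by rw [← mul_assoc, hx]) (by rw [mul_assoc, ha', mul_zero])
        (by rw [← mul_assoc, hx]) (by rw [mul_assoc, hb', mul_zero])
      rw [← mul_add, hxb x _ hab hx hx', hxb x a ha hx hx', hxb x b hb hx hx'] at h1
      linear_combination (norm := noncomm_ring) h1
    linear_combination (norm := noncomm_ring) -h + hB _ hab - hB a ha - hB b hb
  have mulA : ∀ a b, a * e = a → b * e = b → D (a * b) = D a * b + a * D b := by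
    intro a b ha hb
    have hab : a * b * e = a * b := by rw [mul_assoc, hb]
    have hb' : e * b = b := by rw [← hb, hc]
    have h : (D (a * b) - (D a * b + a * D b)) * e = 0 := he.left_faithful _ fun x hx hx' => by
      have h1 := hax (a * b) x hab hx hx'
      rw [mul_assoc a b x, hax a (b * x) ha (by rw [← mul_assoc, hb'])
        (by rw [mul_assoc, hx', mul_zero]), hax b x hb hx hx'] at h1
      linear_combination (norm := noncomm_ring) -h1
    linear_combination (norm := noncomm_ring) h - hA _ hab + D a * hb + a * hA b hb
  have mulB : ∀ a b, e * a = 0 → e * b = 0 → D (a * b) = D a * b + a * D b := by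
    intro a b ha hb
    have hab : e * (a * b) = 0 := by rw [← mul_assoc, ha, zero_mul]
    have ha' : a * e = 0 := by rw [← hc, ← mul_assoc, ha, zero_mul]
    have h : e * (D (a * b) - (D a * b + a * D b)) = D (a * b) - (D a * b + a * D b) :=
        he.right_faithful _ fun x hx hx' => by
      have h1 := hxb x (a * b) hab hx hx'
      rw [← mul_assoc x a b, hxb (x * a) b hb (by rw [← mul_assoc, hx])
        (by rw [mul_assoc, ha', mul_zero]), hxb x a ha hx hx'] at h1
      linear_combination (norm := noncomm_ring) -h1
    linear_combination (norm := noncomm_ring) -h + hB _ hab - hB a ha * b - ha * D b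
  have hA' : ∀ t, t * e * e = t * e := fun t => by rw [mul_assoc, hee]
  have hB' : ∀ t, e * (t - e * t) = 0 := fun t => by rw [mul_sub, ← mul_assoc, hee, sub_self]
  have hB'' : ∀ t, (t - e * t) * e = 0 := fun t => by
    linear_combination (norm := noncomm_ring) - hc t
  refine ⟨fun s t => ?_, fun s t => ?_⟩
  · rw [split (s + t), split s, split t, add_mul, addA _ _ (hA' s) (hA' t),
      show e * (s + t) - (s * e + t * e) = (e * s - s * e) + (e * t - t * e) by noncomm_ring,
      addM _ _ (tM s) (tM' s) (tM t) (tM' t),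
      show s + t - e * (s + t) = (s - e * s) + (t - e * t) by noncomm_ring,
      addB _ _ (hB' s) (hB' t)]
    abel
  · have hm1 : e * (s * e * (e * t - t * e)) = s * e * (e * t - t * e) := by
      rw [← mul_assoc, hc]
    have hm2 : (s * e * (e * t - t * e)) * e = 0 := by rw [mul_assoc, tM', mul_zero]
    have hm3 : e * ((e * s - s * e) * (t - e * t)) = (e * s - s * e) * (t - e * t) := by
      rw [← mul_assoc, tM]
    have hm4 : ((e * s - s * e) * (t - e * t)) * e = 0 := by rw [mul_assoc, hB'', mul_zero]
    rw [split (s * t),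
      show s * t * e = (s * e) * (t * e) by rw [mul_assoc s e, hc, mul_assoc],
      show e * (s * t) - s * e * (t * e) = s * e * (e * t - t * e) + (e * s - s * e) * (t - e * t) by
        linear_combination (norm := noncomm_ring) -2 * (s * hee * t) + hc s * t,
      show s * t - e * (s * t) = (s - e * s) * (t - e * t) by
        linear_combination (norm := noncomm_ring) - hc s * t,
      mulA _ _ (hA' s) (hA' t), addM _ _ hm1 hm2 hm3 hm4, hax _ _ (hA' s) (tM t) (tM' t),
      hxb _ _ (hB' t) (tM s) (tM' s), mulB _ _ (hB' s) (hB' t)]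
    simp only [compA, compM, compB]
    linear_combination (norm := noncomm_ring) 2 * (D s * hee * t) + 2 * (s * hee * D t)

end IsTriangularIdempotent

/-! ### Normalizing a multiplicative Jordan derivation -/

namespace IsTriangularIdempotent

variable {R : Type*} [Ring R] {e : R}

theorem exists_central_add_derivation (he : IsTriangularIdempotent e)
    (h2 : ∀ x y : R, 2 * x = 2 * y → x = y)
    {N : ℕ} (hN : ∀ x y : R, N • x = N • y → x = y) (k : ℕ) {d : R → R}
    (hd : ∀ s t, 2 * d (N • (s * t + t * s)) =
      N • (2 * (d s * t + t * d s + (s * d t + d t * s)) +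
        k • ((s * t + t * s) * d 1 + d 1 * (s * t + t * s))))
    (hk : ∀ x, e * x = x → x * e = 0 → (k + 1) • (e * (x * d e + d e * x) * (1 - e)) = 0) :
    ∃ (a : R) (δ : R → R), (∀ r, a * r = r * a) ∧ IsRingDerivation δ ∧ ∀ t, d t = a * t + δ t := by
  have hee := he.idem
  have hc := he.corner
  have idem : ∀ g, g * g = g → 2 * (d g * g + g * d g) = 2 * d g + (g * d 1 + d 1 * g) := by
    intro g hg
    -- For an idempotent `g`, `g ∘ g = g ∘ 1`; the two expansions are compared.
    have h1 := hd g g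
    have h3 := hd g 1
    rw [mul_one, one_mul] at h3
    rw [hg, h3] at h1
    have h4 := hN _ _ h1
    refine h2 _ _ ?_
    linear_combination (norm := noncomm_ring) -h4
  have comm : ∀ g, g * g = g → (∀ r, g * (r * g) = r * g) →
      d 1 * g = g * d 1 ∧ d g * g = d 1 * g := by
    intro g hg hgc
    have h1 := idem g hg
    have h3 := hgc (d g)
    have h4 := hgc (d 1)
    have h5 : 2 * (d g * g) = g * d 1 + d 1 * g := by
      linear_combination (norm := noncomm_ring) g * h1 - 2 * h3 - 2 * hg * d g + hg * d 1 + h4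
    have h6 : 2 * (d g * g) = 2 * (d 1 * g) := by
      linear_combination (norm := noncomm_ring) h1 * g - 2 * h3 - 2 * d g * hg + d 1 * hg + h4
    refine ⟨?_, h2 _ _ h6⟩
    linear_combination (norm := noncomm_ring) h5 - h6
  obtain ⟨hae, hdee⟩ := comm e hee hc
  have ha : ∀ r, d 1 * r = r * d 1 := he.commute_of_commute_bimodule hae fun x hx hx' => by
    -- For `x` in `M`, `e + x` is again an idempotent `g` with `(1 - g) R g = 0`, so `d 1` commutes
    -- with `e`, with `e + x`, and hence with `x`.
    have h1 := (comm (e + x) (by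
      linear_combination (norm := noncomm_ring) hee + hx + hx' + x * hx - x * hx + hx' * x
        - x * hx) fun r => by
      have h3 : x * (r * e) = 0 := by rw [← hc, ← mul_assoc, hx', zero_mul]
      have h4 : r * x = e * (r * x) := by
        linear_combination (norm := noncomm_ring) -hc r * x - r * hx + e * r * hx
      linear_combination (norm := noncomm_ring) hc r - h4 + h3 + h3 * x - x * r * hx).1
    linear_combination (norm := noncomm_ring) h1 - hae
  have hde : e * d e = d e := h2 _ _ (by
    linear_combination (norm := noncomm_ring) idem e hee - 2 * hdee - ha e)
  have d0 : d 0 = 0 := h2 _ _ (by simpa using hd 0 0)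
  have hef : e * (1 - e) = 0 := by rw [mul_sub, mul_one, hee, sub_self]
  have hfe : (1 - e) * e = 0 := by rw [sub_mul, one_mul, hee, sub_self]
  have hdf : d (1 - e) = d 1 - d e := by
    have h1 := idem (1 - e) (by rw [mul_sub, hfe, sub_zero, mul_one])
    have h3 := hd e (1 - e)
    rw [hef, hfe, add_zero, smul_zero, d0, mul_zero, zero_mul, mul_zero, add_zero, smul_zero,
      add_zero, ← smul_zero N] at h3
    have h4 := h2 0 _ ((mul_zero 2).trans (hN _ _ h3))
    have h5 : 2 * (d (1 - e) - e * d (1 - e) - d (1 - e) * e) = 2 * (d 1 - d 1 * e) := by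
      linear_combination (norm := noncomm_ring) h1 + ha e
    have h6 := h2 _ _ h5
    linear_combination (norm := noncomm_ring) h6 - h4 + hde + hdee
  have hka : (k + 1) • d 1 = 0 := he.eq_zero_of_central
    (fun r => by rw [smul_mul_assoc, ha, mul_smul_comm]) fun x hx hx' => by
      have h1 := hk x hx hx'
      have h3 : x * d e = 0 := by rw [← hde, ← mul_assoc, hx', zero_mul]
      rw [h3, zero_add, show e * (d e * x) * (1 - e) = d 1 * x by
        linear_combination (norm := noncomm_ring) hde * x * (1 - e) - d e * hx' - d e * hx
          + hdee * x + d 1 * hx] at h1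
      rw [smul_mul_assoc, h1]
  -- `m` is the `M`-component of `d e`; the inner derivation `t ↦ t * m - m * t` takes the value
  -- `-m` at `1 - e` and `m` at `e`.
  set m := d e - d 1 * e with hm
  have hme : m * e = 0 := by rw [hm, sub_mul, hdee, mul_assoc, hee, sub_self]
  have hem : e * m = m := by rw [hm, mul_sub, hde, ← mul_assoc, ← ha, mul_assoc, hee]
  have hD := he.isRingDerivation_of_jordan h2 hN (D := fun t => d t - d 1 * t - (t * m - m * t))
    (fun s t => by
      refine h2 _ _ ?_
      have h1 := hd s t
      -- Because `(k + 1) • d 1 = 0`, multiplication by `d 1` satisfies the same perturbed identity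
      -- as `d`; subtracting it removes the `k`-term.
      have h3 : k • ((s * t + t * s) * d 1 + d 1 * (s * t + t * s)) =
          -(2 * (d 1 * (s * t + t * s))) := by
        rw [← ha, ← two_mul]
        have : (k + 1) • (2 * (d 1 * (s * t + t * s))) = 0 := by
          rw [← mul_smul_comm, ← smul_mul_assoc, hka, zero_mul, mul_zero]
        rw [add_smul, one_smul] at this
        exact eq_neg_of_add_eq_zero_left this
      rw [h3] at h1
      rw [mul_sub, mul_sub, h1, mul_smul_comm, mul_smul_comm, smul_mul_assoc, ← smul_sub,
        mul_smul_comm, ← smul_sub, mul_smul_comm, ← smul_sub, mul_smul_comm]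
      congr 1
      linear_combination (norm := noncomm_ring) -2 * (ha t * s) - 2 * (ha s * t))
    (by linear_combination (norm := noncomm_ring) hme - hem - hm)
    (by linear_combination (norm := noncomm_ring) hdf - hme + hem + hm)
  refine ⟨d 1, fun t => d t - d 1 * t, ha, ⟨fun s t => ?_, fun s t => ?_⟩, fun t => ?_⟩
  · linear_combination (norm := noncomm_ring) hD.1 s t
  · linear_combination (norm := noncomm_ring) hD.2 s t
  · noncomm_ring

end IsTriangularIdempotent

/-! ### Specializing the `n`-ary identity -/

section IteratedJordan

variable {R : Type*} [Ring R]

theorem iteratedJordan_succ_succ (n : ℕ) (t : Fin (n + 2) → R) :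
    iteratedJordan (n + 2) t =
      jordanProduct (iteratedJordan (n + 1) (Fin.init t)) (t (Fin.last (n + 1))) := rfl

theorem sum_iteratedJordan_update (n : ℕ) (t u : Fin (n + 2) → R) :
    ∑ i, iteratedJordan (n + 2) (Function.update t i (u i)) =
      jordanProduct
        (∑ i, iteratedJordan (n + 1) (Function.update (Fin.init t) i (Fin.init u i)))
        (t (Fin.last (n + 1))) +
      jordanProduct (iteratedJordan (n + 1) (Fin.init t)) (u (Fin.last (n + 1))) := by
  rw [Fin.sum_univ_castSucc]
  congr 1
  · simp only [iteratedJordan_succ_succ, Fin.init_update_castSucc, jordanProduct, Finset.sum_mul,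
      Finset.mul_sum, ← Finset.sum_add_distrib]
    refine Finset.sum_congr rfl fun i _ => ?_
    rw [Function.update_of_ne (Fin.castSucc_lt_last i).ne']
    rfl
  · rw [iteratedJordan_succ_succ, Fin.init_update_last, Function.update_self]

/-- The sequence `(s, y, y, …)`. -/
def headConst (n : ℕ) (s y : R) : Fin n → R := fun i => if (i : ℕ) = 0 then s else y

/-- The sequence `(s, t, y, y, …)`. -/
def headPairConst (n : ℕ) (s t y : R) : Fin n → R :=
  fun i => if (i : ℕ) = 0 then s else if (i : ℕ) = 1 then t else y

theorem iteratedJordan_headPairConst (k : ℕ) (s t : R) :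
    iteratedJordan (k + 2) (headPairConst (k + 2) s t 1) = 2 ^ k • (s * t + t * s) := by
  induction k with
  | zero => simp [iteratedJordan, headPairConst, jordanProduct, Fin.init]
  | succ k ih =>
    have h : Fin.init (headPairConst (k + 3) s t (1 : R)) = headPairConst (k + 2) s t 1 := rfl
    have h' : headPairConst (k + 3) s t (1 : R) (Fin.last (k + 2)) = 1 := by simp [headPairConst]
    rw [iteratedJordan_succ_succ, h, h', ih, jordanProduct, mul_one, one_mul, ← two_nsmul,
      smul_smul, pow_succ']

/-- Each of the `k` slots holding `1` contributes `2 ^ (k - 1)` times a Jordan product with `a`; the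
outer factor `2` avoids this exponent when `k = 0`. -/
theorem sum_iteratedJordan_headPairConst (k : ℕ) (s t s' t' a : R) :
    2 * ∑ i, iteratedJordan (k + 2)
      (Function.update (headPairConst (k + 2) s t 1) i (headPairConst (k + 2) s' t' a i)) =
    2 ^ k • (2 * (s' * t + t * s' + (s * t' + t' * s)) +
      k • ((s * t + t * s) * a + a * (s * t + t * s))) := by
  induction k with
  | zero =>
    rw [sum_iteratedJordan_update]
    simp [iteratedJordan, headPairConst, jordanProduct, Fin.init]
  | succ k ih =>
    have h : ∀ a : R, Fin.init (headPairConst (k + 3) s t a) = headPairConst (k + 2) s t a :=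
      fun _ => rfl
    have h0 : Fin.init (headPairConst (k + 3) s' t' a) = headPairConst (k + 2) s' t' a := rfl
    have h' : ∀ s t a : R, headPairConst (k + 3) s t a (Fin.last (k + 2)) = a := by
      simp [headPairConst]
    rw [sum_iteratedJordan_update, h, h0, h', h', iteratedJordan_headPairConst, mul_add,
      jordanProduct, mul_one, one_mul, mul_add, ih, jordanProduct, smul_mul_assoc, mul_smul_comm,
      ← smul_add, ← smul_add, mul_smul_comm, ← smul_add, pow_succ, mul_smul]
    congr 1
    rw [add_smul, one_smul]
    noncomm_ring

theorem iteratedJordan_headConst (k : ℕ) {e x : R} (hx : e * x = x) (hx' : x * e = 0) :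
    iteratedJordan (k + 1) (headConst (k + 1) x e) = x := by
  induction k with
  | zero => rfl
  | succ k ih =>
    have h : Fin.init (headConst (k + 2) x e) = headConst (k + 1) x e := rfl
    have h' : headConst (k + 2) x e (Fin.last (k + 1)) = e := by simp [headConst]
    rw [iteratedJordan_succ_succ, h, h', ih, jordanProduct, hx, hx', zero_add]

/-- Compression by `e` and `1 - e` is unchanged by a further Jordan product with `e`, so each slot
contributes its compressed term once, without powers of `2`. -/
theorem sum_iteratedJordan_headConst (k : ℕ) {e x : R} (he : e * e = e) (hx : e * x = x)
    (hx' : x * e = 0) (x' e' : R) :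
    e * (∑ i, iteratedJordan (k + 1)
      (Function.update (headConst (k + 1) x e) i (headConst (k + 1) x' e' i))) * (1 - e) =
    e * x' * (1 - e) + k • (e * (x * e' + e' * x) * (1 - e)) := by
  induction k with
  | zero => simp [iteratedJordan, headConst]
  | succ k ih =>
    have h : ∀ x e : R, Fin.init (headConst (k + 2) x e) = headConst (k + 1) x e :=
      fun _ _ => rfl
    have h' : ∀ x e : R, headConst (k + 2) x e (Fin.last (k + 1)) = e := by
      simp [headConst]
    rw [sum_iteratedJordan_update, h, h, h', h', iteratedJordan_headConst k hx hx', add_smul,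
      one_smul, ← add_assoc, ← ih, jordanProduct, jordanProduct]
    set S := ∑ i, iteratedJordan (k + 1)
      (Function.update (headConst (k + 1) x e) i (headConst (k + 1) x' e' i))
    linear_combination (norm := noncomm_ring) he * S * (1 - e) - e * S * he

theorem IsMultJordanDerivation.headPairConst {k : ℕ} {d : R → R}
    (hd : IsMultJordanDerivation (k + 2) d) (s t : R) :
    2 * d (2 ^ k • (s * t + t * s)) =
      2 ^ k • (2 * (d s * t + t * d s + (s * d t + d t * s)) +
        k • ((s * t + t * s) * d 1 + d 1 * (s * t + t * s))) := by
  rw [← sum_iteratedJordan_headPairConst, ← iteratedJordan_headPairConst, hd]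
  congr 1
  refine Finset.sum_congr rfl fun i _ => ?_
  congr 2
  unfold _root_.headPairConst
  split_ifs <;> rfl

theorem IsMultJordanDerivation.headConst {k : ℕ} {d : R → R}
    (hd : IsMultJordanDerivation (k + 1) d) {e x : R} (he : e * e = e) (hx : e * x = x)
    (hx' : x * e = 0) : k • (e * (x * d e + d e * x) * (1 - e)) = 0 := by
  have h1 := hd (_root_.headConst (k + 1) x e)
  rw [iteratedJordan_headConst k hx hx'] at h1
  have h2 := sum_iteratedJordan_headConst k he hx hx' (d x) (d e)
  have h3 : ∀ i, d (_root_.headConst (k + 1) x e i) = _root_.headConst (k + 1) (d x) (d e) i := by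
    intro i
    unfold _root_.headConst
    split_ifs <;> rfl
  simp only [h3] at h1
  rw [← h1] at h2
  exact left_eq_add.mp h2

theorem two_mul_gen_headPairConst {k : ℕ} {Δ d : R → R}
    (hΔ : ∀ t : Fin (k + 2) → R, Δ (iteratedJordan (k + 2) t) =
      ∑ i : Fin (k + 2), iteratedJordan (k + 2)
        (Function.update t i (if (i : ℕ) = 0 then Δ (t i) else d (t i)))) (s t : R) :
    2 * Δ (2 ^ k • (s * t + t * s)) =
      2 ^ k • (2 * (Δ s * t + t * Δ s + (s * d t + d t * s)) +
        k • ((s * t + t * s) * d 1 + d 1 * (s * t + t * s))) := by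
  rw [← sum_iteratedJordan_headPairConst, ← iteratedJordan_headPairConst, hΔ]
  congr 1
  refine Finset.sum_congr rfl fun i _ => ?_
  congr 2
  unfold headPairConst
  split_ifs <;> rfl

/-- Over a `2`-torsion free ring with a triangular idempotent, a multiplicative generalized Jordan
`n`-derivation is the sum of a central multiplication and a derivation. -/
theorem IsMultGenJordanDerivation.exists_central_add_derivation {e : R}
    (he : IsTriangularIdempotent e) (h2 : ∀ x : R, 2 * x = 0 → x = 0) {n : ℕ} (hn : 2 ≤ n)
    {Δ : R → R} (hΔ : IsMultGenJordanDerivation n Δ) :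
    ∃ (a : R) (δ : R → R), (∀ r, a * r = r * a) ∧ IsRingDerivation δ ∧
      ∀ t, Δ t = a * t + δ t := by
  obtain ⟨k, rfl⟩ := Nat.exists_eq_add_of_le' hn
  obtain ⟨d, hd, hΔ⟩ := hΔ
  have h2' : ∀ x y : R, 2 * x = 2 * y → x = y := fun x y h =>
    sub_eq_zero.mp (h2 _ (by rw [mul_sub, h, sub_self]))
  have hN : ∀ x y : R, 2 ^ k • x = 2 ^ k • y → x = y := by
    clear hd hΔ hn
    induction k with
    | zero => simp
    | succ k ih =>
      intro x y h
      rw [pow_succ, mul_smul, mul_smul] at h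
      exact h2' _ _ (by simpa only [two_nsmul, two_mul] using ih _ _ h)
  obtain ⟨c, hc, hcφ⟩ := he.exists_central_mul h2' hN (φ := fun t => Δ t - d t) fun s t => by
    refine h2' _ _ ?_
    rw [mul_sub, two_mul_gen_headPairConst hΔ, hd.headPairConst, ← smul_sub, mul_smul_comm]
    congr 1
    noncomm_ring
  obtain ⟨a, δ, ha, hδ, h⟩ := he.exists_central_add_derivation h2' hN k hd.headPairConst
    fun x hx hx' => hd.headConst he.idem hx hx'
  refine ⟨c + a, δ, fun r => by rw [add_mul, mul_add, hc, ha], hδ, fun t => ?_⟩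
  rw [add_mul, ← hcφ, add_assoc, ← h, sub_add_cancel]

end IteratedJordan

/-! ### The block triangular ring and its center -/

section BlockUpperTriangular

variable {A : Type*} [Ring A] {r : ℕ} {k : Composition r}

theorem mem_blockUpperTriangularRing {M : Matrix (Fin r) (Fin r) A} :
    M ∈ blockUpperTriangularRing A k ↔ ∀ i j, k.index j < k.index i → M i j = 0 := Iff.rfl

theorem single_mem_blockUpperTriangularRing {i j : Fin r} (h : k.index i ≤ k.index j) (a : A) :
    Matrix.single i j a ∈ blockUpperTriangularRing A k := by
  intro p q hpq
  refine Matrix.single_apply_of_ne _ _ _ _ _ ?_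
  rintro ⟨rfl, rfl⟩
  exact absurd hpq h.not_gt

theorem diagonal_mem_blockUpperTriangularRing (v : Fin r → A) :
    Matrix.diagonal v ∈ blockUpperTriangularRing A k := fun _ _ h =>
  Matrix.diagonal_apply_ne _ fun h' => absurd h (by simp [h'])

/-- The diagonal idempotent of the blocks with index at most `c`. -/
def leadingIdempotent (A : Type*) [Ring A] (k : Composition r) (c : Fin k.length) :
    blockUpperTriangularRing A k :=
  ⟨Matrix.diagonal fun i => if k.index i ≤ c then 1 else 0,
    diagonal_mem_blockUpperTriangularRing _⟩

theorem leadingIdempotent_mul_apply (c : Fin k.length) (M : blockUpperTriangularRing A k)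
    (i j : Fin r) : (leadingIdempotent A k c * M).1 i j = if k.index i ≤ c then M.1 i j else 0 := by
  simp [leadingIdempotent, Matrix.diagonal_mul]

theorem mul_leadingIdempotent_apply (c : Fin k.length) (M : blockUpperTriangularRing A k)
    (i j : Fin r) : (M * leadingIdempotent A k c).1 i j = if k.index j ≤ c then M.1 i j else 0 := by
  simp [leadingIdempotent, Matrix.mul_diagonal]

/-- The cut separates `j₀` from `i₀`. The matrix units `single p i₀ 1` and `single j₀ q 1` then lie
in `M`, and multiplying by them exposes each column `p` before the cut and each row `q` after it. -/
theorem isTriangularIdempotent_leadingIdempotent {i₀ j₀ : Fin r} (h : k.index j₀ < k.index i₀) :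
    IsTriangularIdempotent (leadingIdempotent A k (k.index j₀)) where
  idem := by
    ext i j
    rw [leadingIdempotent_mul_apply]
    simp only [leadingIdempotent, Matrix.diagonal_apply]
    split_ifs <;> rfl
  corner M := by
    ext i j
    rw [leadingIdempotent_mul_apply, mul_leadingIdempotent_apply]
    split_ifs with h1 h2
    · rfl
    · rfl
    · exact (M.2 i j (by omega)).symm
    · rfl
  left_faithful u hu := by
    ext i p
    rw [mul_leadingIdempotent_apply]
    split_ifs with hp
    · let x : blockUpperTriangularRing A k :=
        ⟨Matrix.single p i₀ 1, single_mem_blockUpperTriangularRing (hp.trans h.le) 1⟩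
      have h1 := hu x (by
        ext a b
        rw [leadingIdempotent_mul_apply]
        refine ite_eq_left_iff.mpr fun ha => ?_
        exact (Matrix.single_apply_of_ne _ _ _ _ _ (by rintro ⟨rfl, _⟩; exact ha hp)).symm) (by
        ext a b
        rw [mul_leadingIdempotent_apply]
        simp only [x, Matrix.single_apply]
        split_ifs with h1 h2
        · rw [← h2.2] at h1; exact absurd h h1.not_gt
        · rfl
        · rfl)
      have h2 := congrFun (congrFun (congrArg Subtype.val h1) i) i₀
      simpa [x] using h2
    · rfl
  right_faithful u hu := by
    ext q i
    rw [leadingIdempotent_mul_apply]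
    split_ifs with hq
    · rfl
    · let x : blockUpperTriangularRing A k :=
        ⟨Matrix.single j₀ q 1, single_mem_blockUpperTriangularRing (not_le.mp hq).le 1⟩
      have h1 := hu x (by
        ext a b
        rw [leadingIdempotent_mul_apply]
        refine ite_eq_left_iff.mpr fun ha => ?_
        exact (Matrix.single_apply_of_ne _ _ _ _ _ (by rintro ⟨rfl, _⟩; exact ha le_rfl)).symm) (by
        ext a b
        rw [mul_leadingIdempotent_apply]
        simp only [x, Matrix.single_apply]
        split_ifs with h1 h2
        · rw [← h2.2] at h1; exact absurd h1 hq
        · rfl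
        · rfl)
      have h2 := congrFun (congrFun (congrArg Subtype.val h1) j₀) i
      simpa [x] using h2.symm

theorem index_le_index {i j : Fin r} (h : i ≤ j) : k.index i ≤ k.index j := by
  by_contra! hlt
  have h1 : k.sizeUpTo (k.index j + 1) ≤ k.sizeUpTo (k.index i) := k.monotone_sizeUpTo hlt
  have h2 : (j : ℕ) < k.sizeUpTo (k.index j + 1) := k.lt_sizeUpTo_index_succ j
  have h3 := k.sizeUpTo_index_le i
  omega

/-- Central elements of the block upper triangular ring are central scalars. -/
theorem exists_scalar_of_central (i₀ : Fin r) {z : blockUpperTriangularRing A k}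
    (hz : ∀ t, z * t = t * z) :
    ∃ μ ∈ Subring.center A, ∀ t : blockUpperTriangularRing A k, (z * t).1 = μ • t.1 := by
  have hs : ∀ (i j : Fin r) (h : k.index i ≤ k.index j) (a : A),
      z.1 * Matrix.single i j a = Matrix.single i j a * z.1 := fun i j h a =>
    congrArg Subtype.val (hz ⟨_, single_mem_blockUpperTriangularRing h a⟩)
  have hdiag : ∀ i j, i ≠ j → z.1 i j = 0 := fun i j hij => by
    have h := congrFun (congrFun (hs i i le_rfl 1) i) j
    simpa [hij, hij.symm, Matrix.mul_single_apply_of_ne] using h.symm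
  -- Units on or above the diagonal always belong to the ring, so they suffice to equate all
  -- diagonal entries.
  have hlt : ∀ i j, i ≤ j → z.1 i i = z.1 j j := fun i j hij => by
    simpa using congrFun (congrFun (hs i j (index_le_index hij) 1) i) j
  have heq : ∀ i, z.1 i i = z.1 i₀ i₀ := fun i =>
    (le_total i i₀).elim (hlt i i₀) fun h => (hlt i₀ i h).symm
  refine ⟨z.1 i₀ i₀, Subring.mem_center_iff.mpr fun a => ?_, fun t => ?_⟩
  · simpa using (congrFun (congrFun (hs i₀ i₀ le_rfl a) i₀) i₀).symm
  · ext i j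
    rw [Matrix.smul_apply, smul_eq_mul, ← heq i]
    exact (Matrix.mul_apply).trans
      (Finset.sum_eq_single i (fun l _ hl => by rw [hdiag i l hl.symm, zero_mul]) (by simp))

end BlockUpperTriangular

theorem corollary4p3 {A : Type*} [Ring A] (hA : ∀ a : A, 2 * a = 0 → a = 0)
    (r : ℕ) (hr : 2 ≤ r) (k : Composition r)
    (hk : blockUpperTriangularRing A k ≠ ⊤)
    (n : ℕ) (hn : 2 ≤ n)
    (Δ : blockUpperTriangularRing A k → blockUpperTriangularRing A k)
    (hΔ : IsMultGenJordanDerivation n Δ) :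
    ∃ μ ∈ Subring.center A,
      ∃ δ : blockUpperTriangularRing A k → blockUpperTriangularRing A k,
        IsRingDerivation δ ∧
        ∀ t : blockUpperTriangularRing A k,
          (Δ t : Matrix (Fin r) (Fin r) A) =
            μ • (t : Matrix (Fin r) (Fin r) A) + (δ t : Matrix (Fin r) (Fin r) A) := by
  obtain ⟨i₀, j₀, h⟩ : ∃ i₀ j₀, k.index j₀ < k.index i₀ := by
    by_contra! h
    exact hk (eq_top_iff.mpr fun M _ i j hij => absurd hij (h i j).not_gt)
  have h2 : ∀ x : blockUpperTriangularRing A k, 2 * x = 0 → x = 0 := fun x hx => by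
    ext i j
    refine hA _ ?_
    have h1 := congrFun (congrFun (congrArg Subtype.val hx) i) j
    rw [two_mul] at h1 ⊢
    exact h1
  obtain ⟨z, δ, hz, hδ, hΔ'⟩ := hΔ.exists_central_add_derivation
    (isTriangularIdempotent_leadingIdempotent h) h2 hn
  obtain ⟨μ, hμ, hzμ⟩ := exists_scalar_of_central i₀ hz
  exact ⟨μ, hμ, δ, hδ, fun t => by rw [hΔ' t, ← hzμ t]; rfl⟩
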